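/- Let $c_1,c_2,k_1,k_2,h_1,h_2>0$, $0<t_1<1$, $0<q\le 1$, $s\ge 1$, and let $p(x)=1/x$. Consider on the states $(x_1,x_2,z_1,z_2)$ with $x_1,x_2\ge 0$, $x_1+x_2>0$ the autonomous system \begin{align*} \dot x_i&=k_i\Big\{\big[1-qt_1-qst_1\big(x_i\,p(x_1+x_2)-z_i\big)\big]\big[p(x_1+x_2)+x_i\,p'(x_1+x_2)\big]-c_i\Big\},\\ \dot z_i&=h_i\Big[-(1-q)t_1+qst_1\big(x_i\,p(x_1+x_2)-z_i\big)\Big],\qquad i=1,2, \end{align*} and the state $$x_1^*=\frac{c_2(1-t_1)}{(c_1+c_2)^2},\quad x_2^*=\frac{c_1(1-t_1)}{(c_1+c_2)^2},\quad z_1^*=\frac{c_2}{c_1+c_2}-\frac{1-q}{qs},\quad z_2^*=\frac{c_1}{c_1+c_2}-\frac{1-q}{qs}.$$ This state is stationary. Writing $p',p''$ for $p'(x_1^*+x_2^*)$, $p''(x_1^*+x_2^*)$, the linearization of the system at it is \begin{align*} \dot u_1&=k_1(a_{10}u_1+a_{01}u_2+a_{001}u_3), & \dot u_2&=k_2(b_{10}u_1+b_{01}u_2+b_{001}u_4),\\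 \dot u_3&=h_1(c_{10}u_1+c_{01}u_2+c_{001}u_3), & \dot u_4&=h_2(d_{10}u_1+d_{01}u_2+d_{001}u_4), \end{align*} where \begin{align*} a_{10}&=-qst_1\tfrac{c_1^2}{(1-t_1)^2}+(1-t_1)(2p'+x_1^*p''), & a_{01}&=-qst_1x_1^*p'\tfrac{c_1}{1-t_1}+(1-t_1)(p'+x_1^*p''),\\ b_{01}&=-qst_1\tfrac{c_2^2}{(1-t_1)^2}+(1-t_1)(2p'+x_2^*p''), & b_{10}&=-qst_1x_2^*p'\tfrac{c_2}{1-t_1}+(1-t_1)(p'+x_2^*p''),\\ a_{001}&=c_{10}=\tfrac{qst_1c_1}{1-t_1},\quad b_{001}=d_{01}=\tfrac{qst_1c_2}{1-t_1}, & c_{01}&=qst_1x_1^*p',\quad d_{10}=qst_1x_2^*p',\quad c_{001}=d_{001}=-qst_1. \end{align*} The characteristic polynomial of the linearization is $\lambda^4+m_{43}\lambda^3+m_{42}\lambda^2+m_{41}\lambda+m_{40}$ with \begin{align*} m_{43}&=-k_1a_{10}-k_2b_{01}-h_1c_{001}-h_2d_{001},\\ m_{42}&=k_1k_2a_{10}b_{01}+(k_1a_{10}+k_2b_{01})(h_1c_{001}+h_2d_{001})-h_1k_1a_{001}c_{10}-k_2h_2b_{001}d_{01}\\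 &\quad+h_1h_2c_{001}d_{001}-k_1k_2a_{01}b_{10},\\ m_{41}&=-k_1k_2a_{10}b_{01}(h_1c_{001}+h_2d_{001})-k_1h_1h_2c_{001}d_{001}a_{10}-k_2h_1h_2c_{001}d_{001}b_{01}\\ &\quad+h_1k_1c_{10}a_{001}(k_2b_{01}+h_2d_{001})-k_1k_2h_2b_{001}a_{01}d_{10}+k_1k_2h_2a_{10}b_{001}d_{01}\\ &\quad+k_2h_1h_2b_{001}c_{001}d_{01}+k_1k_2a_{01}b_{10}(h_2d_{001}+h_1c_{001})-k_1k_2h_1a_{001}b_{10}c_{01},\\ m_{40}&=k_1k_2h_1h_2(a_{10}b_{01}c_{001}d_{001}-a_{001}b_{01}c_{10}d_{001}+a_{001}b_{001}c_{10}d_{01}+a_{01}b_{001}c_{001}d_{10}\\ &\quad-a_{001}b_{001}c_{01}d_{10}-a_{10}b_{001}c_{001}d_{01}+a_{001}b_{10}c_{01}d_{001}-a_{01}b_{10}c_{001}d_{001}). \end{align*} Finally, the stationary state $(x_1^*,x_2^*,z_1^*,z_2^*)$ of the nonlinear system is (locally, in the sense of Lyapunov) asymptotically stable if and only if the Routh–Hurwitz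 conditions $$D_1=m_{43}>0,\quad D_2=m_{43}m_{42}-m_{41}>0,\quad D_3=m_{41}D_2-m_{43}^2m_{40}>0,\quad D_4=m_{41}D_3>0$$ hold. -/

import Mathlib

/-- The parameters of the Cournot duopoly with tax evasion: unit costs `c1, c2`, tax rate `t1`,
detection probability `q`, penalty coefficient `s` and adjustment speeds `k1, k2, h1, h2`. -/
structure DuopolyParams where
  c1 : ℝ
  c2 : ℝ
  t1 : ℝ
  q : ℝ
  s : ℝ
  k1 : ℝ
  k2 : ℝ
  h1 : ℝ
  h2 : ℝ

/-- The admissible parameter ranges. -/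
structure DuopolyParams.Admissible (P : DuopolyParams) : Prop where
  c1_pos : 0 < P.c1
  c2_pos : 0 < P.c2
  t1_pos : 0 < P.t1
  t1_lt_one : P.t1 < 1
  q_pos : 0 < P.q
  q_le_one : P.q ≤ 1
  one_le_s : 1 ≤ P.s
  k1_pos : 0 < P.k1
  k2_pos : 0 < P.k2
  h1_pos : 0 < P.h1
  h2_pos : 0 < P.h2

/-- A forward solution of `X' = f(X)`: a curve defined for all `t ≥ 0`, with values in the state
space `U`. -/
def IsForwardSolution {E : Type*} [NormedAddCommGroup E] [NormedSpace ℝ E]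
    (f : E → E) (U : Set E) (X : ℝ → E) : Prop :=
  ∀ t : ℝ, 0 ≤ t → X t ∈ U ∧ HasDerivWithinAt X (f (X t)) (Set.Ici 0) t

/-- (Local) asymptotic stability in the sense of Lyapunov of the state `e` of the autonomous system
`X' = f(X)` on the state space `U`: forward solutions starting near `e` exist for all times, stay
near `e`, and those starting close enough to `e` converge to `e`. -/
def IsAsymptoticallyStable {E : Type*} [NormedAddCommGroup E] [NormedSpace ℝ E]
    (f : E → E) (U : Set E) (e : E) : Prop :=
  (∀ ε : ℝ, 0 < ε → ∃ δ : ℝ, 0 < δ ∧ ∀ X₀ ∈ U, ‖X₀ - e‖ < δ →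
    (∃ X : ℝ → E, IsForwardSolution f U X ∧ X 0 = X₀) ∧
    ∀ X : ℝ → E, IsForwardSolution f U X → X 0 = X₀ → ∀ t : ℝ, 0 ≤ t → ‖X t - e‖ < ε) ∧
  (∃ η : ℝ, 0 < η ∧ ∀ X₀ ∈ U, ‖X₀ - e‖ < η →
    ∀ X : ℝ → E, IsForwardSolution f U X → X 0 = X₀ →
      Filter.Tendsto X Filter.atTop (nhds e))

/-- The inverse demand function `p(x) = 1/x`. -/
noncomputable def price (x : ℝ) : ℝ := 1 / x

namespace DuopolyParams

/-- States are `X = (x₁, x₂, z₁, z₂)`. The outputs are nonnegative and the total output, the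
argument of `p`, is positive. -/
def stateSpace : Set (Fin 4 → ℝ) := {X | 0 ≤ X 0 ∧ 0 ≤ X 1 ∧ 0 < X 0 + X 1}

variable (P : DuopolyParams)

/-- The right-hand side of the dynamic system, for the linear costs `c_i x` and the quadratic
penalty `F(x) = s t₁ x² / 2`. -/
noncomputable def field (X : Fin 4 → ℝ) : Fin 4 → ℝ :=
  ![P.k1 * ((1 - P.q * P.t1 - P.q * P.s * P.t1 * (X 0 * price (X 0 + X 1) - X 2)) *
      (price (X 0 + X 1) + X 0 * deriv price (X 0 + X 1)) - P.c1),
    P.k2 * ((1 - P.q * P.t1 - P.q * P.s * P.t1 * (X 1 * price (X 0 + X 1) - X 3)) *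
      (price (X 0 + X 1) + X 1 * deriv price (X 0 + X 1)) - P.c2),
    P.h1 * (-(1 - P.q) * P.t1 + P.q * P.s * P.t1 * (X 0 * price (X 0 + X 1) - X 2)),
    P.h2 * (-(1 - P.q) * P.t1 + P.q * P.s * P.t1 * (X 1 * price (X 0 + X 1) - X 3))]

/-- The stationary output of firm 1. -/
noncomputable def x1s : ℝ := P.c2 * (1 - P.t1) / (P.c1 + P.c2) ^ 2

/-- The stationary output of firm 2. -/
noncomputable def x2s : ℝ := P.c1 * (1 - P.t1) / (P.c1 + P.c2) ^ 2

/-- The stationary declared revenue of firm 1. -/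
noncomputable def z1s : ℝ := P.c2 / (P.c1 + P.c2) - (1 - P.q) / (P.q * P.s)

/-- The stationary declared revenue of firm 2. -/
noncomputable def z2s : ℝ := P.c1 / (P.c1 + P.c2) - (1 - P.q) / (P.q * P.s)

/-- The stationary state `(x₁*, x₂*, z₁*, z₂*)`. -/
noncomputable def stationaryState : Fin 4 → ℝ := ![P.x1s, P.x2s, P.z1s, P.z2s]

/-- `p'(x₁* + x₂*)`. -/
noncomputable def dp : ℝ := deriv price (P.x1s + P.x2s)

/-- `p''(x₁* + x₂*)`. -/
noncomputable def ddp : ℝ := deriv (deriv price) (P.x1s + P.x2s)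

/-- The coefficients of the linearized system. -/
noncomputable def a10 : ℝ :=
  -(P.q * P.s * P.t1) * (P.c1 ^ 2 / (1 - P.t1) ^ 2) + (1 - P.t1) * (2 * P.dp + P.x1s * P.ddp)

noncomputable def a01 : ℝ :=
  -(P.q * P.s * P.t1) * P.x1s * P.dp * (P.c1 / (1 - P.t1)) +
    (1 - P.t1) * (P.dp + P.x1s * P.ddp)

noncomputable def a001 : ℝ := P.q * P.s * P.t1 * P.c1 / (1 - P.t1)

noncomputable def b10 : ℝ :=
  -(P.q * P.s * P.t1) * P.x2s * P.dp * (P.c2 / (1 - P.t1)) +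
    (1 - P.t1) * (P.dp + P.x2s * P.ddp)

noncomputable def b01 : ℝ :=
  -(P.q * P.s * P.t1) * (P.c2 ^ 2 / (1 - P.t1) ^ 2) + (1 - P.t1) * (2 * P.dp + P.x2s * P.ddp)

noncomputable def b001 : ℝ := P.q * P.s * P.t1 * P.c2 / (1 - P.t1)

noncomputable def c10 : ℝ := P.q * P.s * P.t1 * P.c1 / (1 - P.t1)

noncomputable def c01 : ℝ := P.q * P.s * P.t1 * P.x1s * P.dp

noncomputable def c001 : ℝ := -(P.q * P.s * P.t1)

noncomputable def d10 : ℝ := P.q * P.s * P.t1 * P.x2s * P.dp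

noncomputable def d01 : ℝ := P.q * P.s * P.t1 * (P.c2 / (1 - P.t1))

noncomputable def d001 : ℝ := -(P.q * P.s * P.t1)

/-- The matrix of the linearized system `u' = A u`. -/
noncomputable def linearization : Matrix (Fin 4) (Fin 4) ℝ :=
  !![P.k1 * P.a10, P.k1 * P.a01, P.k1 * P.a001, 0;
     P.k2 * P.b10, P.k2 * P.b01, 0, P.k2 * P.b001;
     P.h1 * P.c10, P.h1 * P.c01, P.h1 * P.c001, 0;
     P.h2 * P.d10, P.h2 * P.d01, 0, P.h2 * P.d001]

/-- The coefficients of the characteristic polynomial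
`λ⁴ + m43 λ³ + m42 λ² + m41 λ + m40` of the linearized system. -/
noncomputable def m43 : ℝ := -P.k1 * P.a10 - P.k2 * P.b01 - P.h1 * P.c001 - P.h2 * P.d001

noncomputable def m42 : ℝ :=
  P.k1 * P.k2 * P.a10 * P.b01 + (P.k1 * P.a10 + P.k2 * P.b01) * (P.h1 * P.c001 + P.h2 * P.d001)
    - P.h1 * P.k1 * P.a001 * P.c10 - P.k2 * P.h2 * P.b001 * P.d01
    + P.h1 * P.h2 * P.c001 * P.d001 - P.k1 * P.k2 * P.a01 * P.b10

noncomputable def m41 : ℝ :=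
  -P.k1 * P.k2 * P.a10 * P.b01 * (P.h1 * P.c001 + P.h2 * P.d001)
    - P.k1 * P.h1 * P.h2 * P.c001 * P.d001 * P.a10
    - P.k2 * P.h1 * P.h2 * P.c001 * P.d001 * P.b01
    + P.h1 * P.k1 * P.c10 * P.a001 * (P.k2 * P.b01 + P.h2 * P.d001)
    - P.k1 * P.k2 * P.h2 * P.b001 * P.a01 * P.d10
    + P.k1 * P.k2 * P.h2 * P.a10 * P.b001 * P.d01
    + P.k2 * P.h1 * P.h2 * P.b001 * P.c001 * P.d01
    + P.k1 * P.k2 * P.a01 * P.b10 * (P.h2 * P.d001 + P.h1 * P.c001)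
    - P.k1 * P.k2 * P.h1 * P.a001 * P.b10 * P.c01

noncomputable def m40 : ℝ :=
  P.k1 * P.k2 * P.h1 * P.h2 *
    (P.a10 * P.b01 * P.c001 * P.d001 - P.a001 * P.b01 * P.c10 * P.d001
      + P.a001 * P.b001 * P.c10 * P.d01 + P.a01 * P.b001 * P.c001 * P.d10
      - P.a001 * P.b001 * P.c01 * P.d10 - P.a10 * P.b001 * P.c001 * P.d01
      + P.a001 * P.b10 * P.c01 * P.d001 - P.a01 * P.b10 * P.c001 * P.d001)

/-- The quantities of the Routh-Hurwitz conditions. -/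
noncomputable def D1 : ℝ := P.m43

noncomputable def D2 : ℝ := P.m43 * P.m42 - P.m41

noncomputable def D3 : ℝ := P.m41 * P.D2 - P.m43 ^ 2 * P.m40

noncomputable def D4 : ℝ := P.m41 * P.D3

/-- The Routh-Hurwitz conditions. -/
def RouthHurwitz : Prop := 0 < P.D1 ∧ 0 < P.D2 ∧ 0 < P.D3 ∧ 0 < P.D4

end DuopolyParams

/-! For admissible parameters both sides of the equivalence are true. In the scaled variables of
`hurwitz_pos` the coefficients of the characteristic polynomial and the Hurwitz determinants become
polynomials in positive quantities with only positive coefficients (`hurwitz_determinants_pos`), so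
the Routh–Hurwitz conditions always hold.

Stability then follows by Lyapunov's indirect method. The conditions put all eigenvalues in the open
left half-plane (`re_neg_of_quartic_routhHurwitz`). Cayley–Hamilton and an induction over the roots
turn this into a quadratic form that decreases along the linear flow (`exists_lyapunov_of_roots`).
The same form decreases along the nonlinear flow near the equilibrium and forces exponential decay
(`isAsymptoticallyStable_of_lyapunov`). Global existence of solutions comes from a truncated field.
-/

/-! ### Routh–Hurwitz criterion for quartics -/

/-- A complex root of a real quartic satisfying the Routh-Hurwitz conditions has negative real
part. -/
theorem re_neg_of_quartic_routhHurwitz {m3 m2 m1 m0 : ℝ} (h3 : 0 < m3) (h1 : 0 < m1) (h0 : 0 < m0)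
    (h2 : 0 < m2) (hD : 0 < m1 * (m3 * m2 - m1) - m3 ^ 2 * m0) {z : ℂ}
    (hz : z ^ 4 + m3 * z ^ 3 + m2 * z ^ 2 + m1 * z + m0 = 0) : z.re < 0 := by
  obtain ⟨x, y⟩ := z
  by_contra! hx
  simp only at hx
  have hre := congrArg Complex.re hz
  have him := congrArg Complex.im hz
  simp only [pow_succ, pow_zero, one_mul, Complex.add_re, Complex.mul_re, Complex.mul_im,
    Complex.ofReal_re, Complex.ofReal_im, Complex.zero_re, Complex.zero_im, Complex.add_im]
    at hre him
  by_cases hy : y = 0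
  · subst hy
    have : 0 < x ^ 4 + m3 * x ^ 3 + m2 * x ^ 2 + m1 * x + m0 := by positivity
    linarith
  -- For a non-real root `z`, `X² + αX + β` is its real quadratic factor and `X² + γX + δ` the
  -- quotient. Both coefficients of the remainder vanish because it is linear and has the non-real
  -- root `z`.
  set α : ℝ := -2 * x with hα
  set β : ℝ := x ^ 2 + y ^ 2 with hβ
  set γ : ℝ := m3 - α with hγ
  set δ : ℝ := m2 - β - α * γ with hδ
  have e1 : m1 = α * δ + β * γ := by
    have : y * (m1 - (α * δ + β * γ)) = 0 := by
      rw [hδ, hγ, hβ, hα]; linear_combination him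
    rcases mul_eq_zero.1 this with h | h
    · exact absurd h hy
    · linarith
  have e0 : m0 = β * δ := by
    have : (m1 - (α * δ + β * γ)) * x + (m0 - β * δ) = 0 := by
      rw [hδ, hγ, hβ, hα]; linear_combination hre
    rw [e1] at this; linarith
  have e2 : m2 = β + δ + α * γ := by rw [hδ]; ring
  have e3 : m3 = α + γ := by rw [hγ]; ring
  have hα0 : α ≤ 0 := by rw [hα]; linarith
  have hγ0 : 0 ≤ γ := by linarith
  -- Orlando's formula: the determinant is the product of the pairwise sums of the roots. The factor
  -- `α * γ` collects the sums within each quadratic factor and carries the sign.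
  have key : m1 * (m3 * m2 - m1) - m3 ^ 2 * m0 = α * γ * ((β - δ) ^ 2 + m3 * m1) := by
    rw [e0, e1, e2, e3]; ring
  have : α * γ * ((β - δ) ^ 2 + m3 * m1) ≤ 0 :=
    mul_nonpos_of_nonpos_of_nonneg (mul_nonpos_of_nonpos_of_nonneg hα0 hγ0) (by positivity)
  linarith

/-! ### Quadratic Lyapunov forms from the spectrum -/

open Polynomial in
/-- If a polynomial in `A` with roots in the open left half-plane kills `v`, then a quadratic
Lyapunov form for `v' = A v` exists on the space of such `v`. -/
theorem exists_lyapunov_of_roots {F : Type*} [NormedAddCommGroup F] [InnerProductSpace ℂ F]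
    (A : F →L[ℂ] F) (s : Multiset ℂ) (hs : ∀ z ∈ s, z.re < 0) :
    ∃ (B : F →L[ℝ] F →L[ℝ] ℝ) (c : ℝ), 0 < c ∧
      ∀ v, aeval A (s.map fun z => X - C z).prod v = 0 →
        ‖v‖ ^ 2 ≤ B v v ∧ B v (A v) + B (A v) v ≤ -c * ‖v‖ ^ 2 := by
  let _ : InnerProductSpace ℝ F := InnerProductSpace.complexToReal
  induction s using Multiset.induction with
  | empty =>
    refine ⟨0, 1, one_pos, fun v hv => ?_⟩
    have : v = 0 := by simpa using hv
    simp [this]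
  | cons z s ih =>
    obtain ⟨B, c, hc, hB⟩ := ih fun w hw => hs w (Multiset.mem_cons_of_mem hw)
    have hz : z.re < 0 := hs z (Multiset.mem_cons_self z s)
    set D : F →L[ℂ] F := A - algebraMap ℂ (F →L[ℂ] F) z with hD
    have hDv : ∀ v, D v = A v - z • v := fun v => by
      simp [hD, Algebra.algebraMap_eq_smul_one]
    set Dr : F →L[ℝ] F := D.restrictScalars ℝ with hDr
    -- The new form is `‖v‖² + κ B(Dv, Dv)` with `D = A - z`. This `κ` lets the decrease of the
    -- second term absorb the cross term `2⟪v, Dv⟫` by Young's inequality, leaving `z.re * ‖v‖²`.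
    set κ : ℝ := 1 / (c * -z.re) with hκ
    have hκ0 : 0 < κ := by rw [hκ]; exact one_div_pos.2 (mul_pos hc (by linarith))
    set I : F →L[ℝ] F →L[ℝ] ℝ := innerSL ℝ
    refine ⟨I + κ • B.bilinearComp Dr Dr, -z.re, by linarith, fun v hv => ?_⟩
    have hv' : aeval A (s.map fun z => X - C z).prod (D v) = 0 := by
      rw [Multiset.map_cons, Multiset.prod_cons, mul_comm, map_mul] at hv
      simpa [hD] using hv
    obtain ⟨hpos, hdec⟩ := hB (D v) hv'
    have hcomm : D (A v) = A (D v) := by simp [hDv]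
    have hinner : inner ℝ v (A v) = z.re * ‖v‖ ^ 2 + inner ℝ v (D v) := by
      have : A v = z • v + D v := by simp [hDv]
      rw [this, inner_add_right]
      congr 1
      change (inner ℂ v (z • v)).re = _
      rw [inner_smul_right, inner_self_eq_norm_sq_to_K]
      simp [← Complex.ofReal_pow]
    have hcs : inner ℝ v (D v) ≤ ‖v‖ * ‖D v‖ := real_inner_le_norm _ _
    have hIapp : ∀ u w, I u w = inner ℝ u w := fun _ _ => rfl
    have happ : ∀ u w, (I + κ • B.bilinearComp Dr Dr) u w =
        inner ℝ u w + κ * B (D u) (D w) := fun u w => by simp [hDr, hIapp]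
    simp only [happ, hcomm]
    rw [real_inner_self_eq_norm_sq, real_inner_comm v (A v), hinner]
    constructor
    · nlinarith [mul_nonneg hκ0.le ((sq_nonneg _).trans hpos)]
    · have h1 : κ * (B (D v) (A (D v)) + B (A (D v)) (D v)) ≤ κ * (-c * ‖D v‖ ^ 2) :=
        mul_le_mul_of_nonneg_left hdec hκ0.le
      have h2 : κ * c = 1 / -z.re := by
        rw [hκ]; field_simp
      have h3 : 2 * (‖v‖ * ‖D v‖) ≤ -z.re * ‖v‖ ^ 2 + 1 / -z.re * ‖D v‖ ^ 2 := by
        have : 0 < -z.re := by linarith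
        have h4 : 0 ≤ (-z.re * ‖v‖ - ‖D v‖) ^ 2 / -z.re := by positivity
        have h5 : (-z.re * ‖v‖ - ‖D v‖) ^ 2 / -z.re =
            -z.re * ‖v‖ ^ 2 + 1 / -z.re * ‖D v‖ ^ 2 - 2 * (‖v‖ * ‖D v‖) := by
          have : z.re ≠ 0 := hz.ne
          field_simp; ring
        linarith
      rw [← h2] at h3
      linarith

open Polynomial in
/-- A real matrix whose complex eigenvalues have negative real part admits a quadratic Lyapunov
form. -/
theorem Matrix.exists_lyapunov {n : Type*} [Fintype n] [DecidableEq n] (M : Matrix n n ℝ)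
    (hM : ∀ z ∈ (M.charpoly.map (algebraMap ℝ ℂ)).roots, z.re < 0) :
    ∃ (B : (n → ℝ) →L[ℝ] (n → ℝ) →L[ℝ] ℝ) (m c : ℝ), 0 < m ∧ 0 < c ∧
      ∀ u, m * ‖u‖ ^ 2 ≤ B u u ∧ B u (M.mulVec u) + B (M.mulVec u) u ≤ -c * ‖u‖ ^ 2 := by
  set N : Matrix n n ℂ := M.map (algebraMap ℝ ℂ) with hN
  set A : EuclideanSpace ℂ n →L[ℂ] EuclideanSpace ℂ n := Matrix.toEuclideanCLM (𝕜 := ℂ) N with hA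
  obtain ⟨B, c, hc, hB⟩ := exists_lyapunov_of_roots A _ hM
  -- By Cayley–Hamilton the product over all eigenvalues kills every vector, so the form found above
  -- works on the whole space.
  have hCH : aeval A ((M.charpoly.map (algebraMap ℝ ℂ)).roots.map fun z => X - C z).prod = 0 := by
    rw [← (IsAlgClosed.splits (M.charpoly.map (algebraMap ℝ ℂ))).eq_prod_roots_of_monic
      (M.charpoly_monic.map _), ← Matrix.charpoly_map, hA]
    have := Polynomial.aeval_algHom_apply
      ((Matrix.toEuclideanCLM (n := n) (𝕜 := ℂ)).toAlgEquiv : _ ≃ₐ[ℂ] _).toAlgHom N N.charpoly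
    rw [Matrix.aeval_self_charpoly, map_zero] at this
    exact this
  set J : (n → ℝ) →ₗ[ℝ] EuclideanSpace ℂ n :=
    { toFun := fun u => WithLp.toLp 2 fun i => (u i : ℂ)
      map_add' := fun u v => by ext i; simp
      map_smul' := fun a v => by ext i; simp } with hJ
  set ι : (n → ℝ) →L[ℝ] EuclideanSpace ℂ n := LinearMap.toContinuousLinearMap J with hι
  have hιA : ∀ u, A (ι u) = ι (M.mulVec u) := fun u => by
    ext i
    simp [hA, hι, hJ, hN, Matrix.mulVec, dotProduct]
  have hnorm : ∀ u, ‖u‖ ≤ ‖ι u‖ := fun u => by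
    refine (pi_norm_le_iff_of_nonneg (norm_nonneg _)).2 fun i => ?_
    have := PiLp.norm_apply_le (ι u) i
    simpa [hι, hJ] using this
  refine ⟨B.bilinearComp ι ι, 1, c, one_pos, hc, fun u => ?_⟩
  obtain ⟨h1, h2⟩ := hB (ι u) (by rw [hCH]; rfl)
  have h3 : ‖u‖ ^ 2 ≤ ‖ι u‖ ^ 2 := by gcongr; exact hnorm u
  rw [hιA] at h2
  simp only [ContinuousLinearMap.bilinearComp_apply]
  exact ⟨by linarith, h2.trans (by nlinarith)⟩

/-! ### Global forward solutions and truncation of the field -/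

open Set Filter Topology Metric

/-- A bounded, globally Lipschitz vector field has a forward solution through every point. -/
theorem exists_isForwardSolution_of_lipschitzWith {E : Type*} [NormedAddCommGroup E]
    [NormedSpace ℝ E] [CompleteSpace E] {g : E → E} {K L : NNReal} (hg : LipschitzWith K g)
    (hL : ∀ x, ‖g x‖ ≤ L) (x₀ : E) : ∃ X : ℝ → E, IsForwardSolution g univ X ∧ X 0 = x₀ := by
  have hex : ∀ n : ℕ, ∃ α : ℝ → E, α 0 = x₀ ∧
      ∀ t ∈ Icc (0 : ℝ) n, HasDerivWithinAt α (g (α t)) (Icc (0 : ℝ) n) t := fun n => by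
    -- With speed at most `L`, a solution cannot leave the ball of radius `L * n` before time `n`,
    -- so no smallness of the time interval is needed.
    have hpl : IsPicardLindelof (fun _ => g) (⟨0, le_rfl, n.cast_nonneg⟩ : Icc (0 : ℝ) n) x₀
        (L * n) 0 L K :=
      .of_time_independent (fun x _ => hL x) hg.lipschitzOnWith (by simp)
    exact hpl.exists_eq_forall_mem_Icc_hasDerivWithinAt₀
  choose α hα0 hα using hex
  have hagree : ∀ {n m : ℕ} {t : ℝ}, 0 ≤ t → t ≤ n → t ≤ m → α n t = α m t := by
    intro n m t ht hn hm
    have hcont : ∀ {k : ℕ}, t ≤ k → ContinuousOn (α k) (Icc 0 t) := fun {k} hk s hs =>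
      ((hα k s ⟨hs.1, hs.2.trans hk⟩).mono (Icc_subset_Icc_right hk)).continuousWithinAt
    have hder : ∀ {k : ℕ}, t ≤ k → ∀ s ∈ Ico 0 t,
        HasDerivWithinAt (α k) (g (α k s)) (Ici s) s := fun {k} hk s hs =>
      (hα k s ⟨hs.1, hs.2.le.trans hk⟩).mono_of_mem_nhdsWithin <|
        mem_of_superset (Icc_mem_nhdsGE (hs.2.trans_le hk)) (Icc_subset_Icc_left hs.1)
    exact ODE_solution_unique (v := fun _ => g) (fun _ => hg) (hcont hn) (hder hn) (hcont hm)
      (hder hm) (by rw [hα0, hα0]) ⟨ht, le_rfl⟩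
  -- The `+ 1` makes the index strictly exceed `t`, so `[0, n]` is a neighbourhood of `t` within
  -- `[0, ∞)`.
  refine ⟨fun t => α (⌊t⌋₊ + 1) t, fun t ht => ⟨mem_univ _, ?_⟩, hα0 _⟩
  set n := ⌊t⌋₊ + 1 with hn
  have hlt : ∀ s : ℝ, s < ((⌊s⌋₊ + 1 : ℕ) : ℝ) := fun s => by
    push_cast; exact Nat.lt_floor_add_one s
  have htn : t < n := hlt t
  refine HasDerivWithinAt.mono_of_mem_nhdsWithin (t := Icc 0 (n : ℝ)) ?_ ?_
  · exact (hα n t ⟨ht, htn.le⟩).congr (fun s hs => hagree hs.1 (hlt s).le hs.2) rfl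
  · rw [← Ici_inter_Iic]
    exact inter_mem self_mem_nhdsWithin (mem_nhdsWithin_of_mem_nhds (Iic_mem_nhds htn))

/-- A vector field that is Lipschitz on a ball of `ι → ℝ` agrees there with a bounded, globally
Lipschitz one. -/
theorem LipschitzOnWith.exists_eqOn_closedBall_bounded {ι F : Type*} [Fintype ι]
    [NormedAddCommGroup F] {f : (ι → ℝ) → F} {e : ι → ℝ} {r : ℝ} {K : NNReal} (hr : 0 ≤ r)
    (hf : LipschitzOnWith K f (closedBall e r)) :
    ∃ (g : (ι → ℝ) → F) (L : NNReal), LipschitzWith K g ∧ (∀ x, ‖g x‖ ≤ L) ∧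
      EqOn g f (closedBall e r) := by
  -- Coordinatewise clamping is a 1-Lipschitz retraction onto the ball, which is a cube in the sup
  -- norm.
  set π : (ι → ℝ) → (ι → ℝ) := fun x i => max (e i - r) (min (e i + r) (x i)) with hπ
  have hπmem : ∀ x, π x ∈ closedBall e r := fun x => by
    refine (dist_pi_le_iff hr).2 fun i => ?_
    rw [Real.dist_eq, abs_le]
    have h1 : e i - r ≤ π x i := le_max_left _ _
    have h2 : π x i ≤ e i + r := max_le (by linarith) (min_le_left _ _)
    constructor <;> linarith
  have hπL : LipschitzWith 1 π := LipschitzWith.of_dist_le_mul fun x y => by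
    rw [NNReal.coe_one, one_mul]
    refine (dist_pi_le_iff dist_nonneg).2 fun i => le_trans ?_ (dist_le_pi_dist x y i)
    simp only [hπ, Real.dist_eq]
    have h1 := abs_max_sub_max_le_max (e i - r) (min (e i + r) (x i)) (e i - r)
      (min (e i + r) (y i))
    have h2 := abs_min_sub_min_le_max (e i + r) (x i) (e i + r) (y i)
    rw [sub_self, abs_zero, max_eq_right (abs_nonneg (_ : ℝ))] at h1 h2
    exact h1.trans h2
  have hπeq : EqOn π id (closedBall e r) := fun x hx => by
    funext i
    have := (dist_pi_le_iff hr).1 hx i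
    rw [Real.dist_eq, abs_le] at this
    simp only [hπ, id]
    rw [min_eq_right (by linarith), max_eq_right (by linarith)]
  refine ⟨f ∘ π, K * ⟨r, hr⟩ + ‖f e‖₊, ?_, fun x => ?_, fun x hx => ?_⟩
  · have := hf.comp (hπL.lipschitzOnWith (s := univ)) fun x _ => hπmem x
    rwa [mul_one, lipschitzOnWith_univ] at this
  · have h1 := hf.dist_le_mul _ (hπmem x) e (mem_closedBall_self hr)
    have h2 : dist (π x) e ≤ r := hπmem x
    have h3 : (K : ℝ) * dist (π x) e ≤ K * r := by gcongr
    rw [dist_eq_norm] at h1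
    have h4 := norm_le_norm_sub_add (f (π x)) (f e)
    change ‖f (π x)‖ ≤ K * r + ‖f e‖
    linarith
  · simp [hπeq hx]

/-! ### Lyapunov's indirect method -/

/-- Along a solution, a quadratic form that is strictly decreased by the field in the ball of radius
`r` decays exponentially if its initial value is small. -/
theorem norm_sq_le_exp_of_lyapunov {E : Type*} [NormedAddCommGroup E] [NormedSpace ℝ E]
    {f : E → E} {e : E} {U : Set E} {B : E →L[ℝ] E →L[ℝ] ℝ} {m N c r b : ℝ} (hm : 0 < m)
    (hN : 0 < N) (hc : 0 < c) (hr : 0 < r) (hb : 0 < b) (hbr : b < m * r ^ 2)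
    (hmB : ∀ u, m * ‖u‖ ^ 2 ≤ B u u) (hNB : ∀ u, B u u ≤ N * ‖u‖ ^ 2)
    (hdec : ∀ u, ‖u‖ ≤ r → B u (f (e + u)) + B (f (e + u)) u ≤ -c * ‖u‖ ^ 2)
    {X : ℝ → E} (hX : IsForwardSolution f U X) (h0 : B (X 0 - e) (X 0 - e) ≤ b) {t : ℝ}
    (ht : 0 ≤ t) : ‖X t - e‖ ^ 2 ≤ b / m * Real.exp (-(c / (2 * N)) * t) := by
  -- Half the available rate `c / N`: the comparison lemma needs a strict inequality of derivatives
  -- where the form meets the barrier. Since `b < m * r ^ 2`, at such times the solution is inside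
  -- the ball, so confinement need not be known beforehand.
  set γ := c / (2 * N) with hγ
  have hγ0 : 0 < γ := by positivity
  have hder : ∀ s ∈ Ici (0 : ℝ), HasDerivWithinAt (fun s => B (X s - e) (X s - e))
      (B (X s - e) (f (X s)) + B (f (X s)) (X s - e)) (Ici 0) s := fun s hs =>
    B.hasDerivWithinAt_of_bilinear ((hX s hs).2.sub_const e) ((hX s hs).2.sub_const e)
  have hbound := image_le_of_deriv_right_lt_deriv_boundary (a := 0) (b := t)
    (f := fun s => B (X s - e) (X s - e))
    (f' := fun s => B (X s - e) (f (X s)) + B (f (X s)) (X s - e))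
    (B := fun s => b * Real.exp (-γ * s)) (B' := fun s => b * (Real.exp (-γ * s) * (-γ * 1)))
    (fun s hs => (hder s hs.1).continuousWithinAt.mono Icc_subset_Ici_self)
    (fun s hs => (hder s hs.1).mono (Ici_subset_Ici.2 hs.1)) (by simpa using h0)
    (fun s => (((hasDerivAt_id s).const_mul (-γ)).exp).const_mul b) ?_ ⟨ht, le_rfl⟩
  · have := (hmB (X t - e)).trans hbound
    rw [div_mul_eq_mul_div, le_div_iff₀ hm]
    linarith
  · intro s hs heq
    set u := X s - e with hu
    have hexp : Real.exp (-γ * s) ≤ 1 := Real.exp_le_one_iff.2 (by nlinarith [hs.1])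
    have hexp0 : 0 < Real.exp (-γ * s) := Real.exp_pos _
    have hur : ‖u‖ ≤ r := by
      have h1 : m * ‖u‖ ^ 2 < m * r ^ 2 :=
        (hmB u).trans_lt (by rw [heq]; nlinarith)
      exact (lt_of_pow_lt_pow_left₀ 2 hr.le (lt_of_mul_lt_mul_left h1 hm.le)).le
    have h2 := hdec u hur
    rw [show e + u = X s by rw [hu]; abel] at h2
    have h3 : 0 < b * Real.exp (-γ * s) := by positivity
    have h4 : 2 * γ * B u u ≤ c * ‖u‖ ^ 2 := by
      have : 2 * γ * N = c := by rw [hγ]; field_simp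
      rw [← this, mul_assoc _ N]
      exact mul_le_mul_of_nonneg_left (hNB u) (by positivity)
    rw [heq] at h4
    nlinarith

/-- **Lyapunov's indirect method**: a zero of a `C¹` vector field whose linearization has a strict
quadratic Lyapunov form is asymptotically stable. -/
theorem isAsymptoticallyStable_of_lyapunov {ι : Type*} [Fintype ι] {f : (ι → ℝ) → (ι → ℝ)}
    {e : ι → ℝ} {U : Set (ι → ℝ)} {A : (ι → ℝ) →L[ℝ] (ι → ℝ)} (hU : U ∈ 𝓝 e) (hfe : f e = 0)
    (hf : ContDiffAt ℝ 1 f e) (hA : HasFDerivAt f A e) {B : (ι → ℝ) →L[ℝ] (ι → ℝ) →L[ℝ] ℝ}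
    {m c : ℝ} (hm : 0 < m) (hc : 0 < c) (hmB : ∀ u, m * ‖u‖ ^ 2 ≤ B u u)
    (hAB : ∀ u, B u (A u) + B (A u) u ≤ -c * ‖u‖ ^ 2) : IsAsymptoticallyStable f U e := by
  set N := ‖B‖ + 1 with hN
  have hN0 : 0 < N := by positivity
  have hB : ∀ u v, |B u v| ≤ N * ‖u‖ * ‖v‖ := fun u v =>
    (B.le_opNorm₂ u v).trans (by gcongr; linarith)
  have hNB : ∀ u, B u u ≤ N * ‖u‖ ^ 2 := fun u => by
    have := (le_abs_self _).trans (hB u u)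
    linarith
  obtain ⟨K, s, hs, hK⟩ := hf.exists_lipschitzOnWith
  -- With this constant each of the two error terms costs at most `c / 4 * ‖u‖ ^ 2`, so half of the
  -- decrease survives.
  have hlin : ∀ᶠ x in 𝓝 e, ‖f x - f e - A (x - e)‖ ≤ c / (4 * N) * ‖x - e‖ :=
    hA.isLittleO.bound (by positivity)
  obtain ⟨r, hr, hball⟩ := nhds_basis_closedBall.mem_iff.1 (inter_mem (inter_mem hU hs) hlin)
  have hdec : ∀ u, ‖u‖ ≤ r → B u (f (e + u)) + B (f (e + u)) u ≤ -(c / 2) * ‖u‖ ^ 2 := by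
    intro u hu
    have hmem : e + u ∈ closedBall e r := by simpa [mem_closedBall, dist_eq_norm] using hu
    have h1 : ‖f (e + u) - f e - A (e + u - e)‖ ≤ c / (4 * N) * ‖e + u - e‖ := (hball hmem).2
    rw [hfe, sub_zero, add_sub_cancel_left] at h1
    set w := f (e + u) - A u with hw
    have h2 : f (e + u) = A u + w := by rw [hw]; abel
    rw [h2, map_add, map_add, add_apply]
    have h3 := (le_abs_self _).trans (hB u w)
    have h4 := (le_abs_self _).trans (hB w u)
    have h5 : N * ‖u‖ * ‖w‖ ≤ N * ‖u‖ * (c / (4 * N) * ‖u‖) := by gcongr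
    have h6 : N * ‖u‖ * (c / (4 * N) * ‖u‖) = c / 4 * ‖u‖ ^ 2 := by field_simp
    have h7 := hAB u
    nlinarith
  have hinit : ∀ b, 0 < b → ∃ δ, 0 < δ ∧ ∀ x, ‖x - e‖ < δ → B (x - e) (x - e) ≤ b := by
    intro b hb
    refine ⟨√(b / N), Real.sqrt_pos.2 (by positivity), fun x hx => (hNB _).trans ?_⟩
    have h1 : ‖x - e‖ ^ 2 ≤ b / N := by
      rw [← Real.sq_sqrt (show 0 ≤ b / N by positivity)]
      gcongr
    calc N * ‖x - e‖ ^ 2 ≤ N * (b / N) := by gcongr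
      _ = b := by field_simp
  -- Allowing any `g` that agrees with `f` on the ball covers both `f` itself and the truncated
  -- field. Solutions of the latter are thereby confined to the ball, hence solve the original
  -- system inside `U`.
  have hstay : ∀ {g : (ι → ℝ) → (ι → ℝ)} {V : Set (ι → ℝ)} {X : ℝ → ι → ℝ} {ε : ℝ},
      0 < ε → ε ≤ r → EqOn g f (closedBall e r) → IsForwardSolution g V X →
      B (X 0 - e) (X 0 - e) ≤ m * ε ^ 2 / 2 → ∀ t, 0 ≤ t →
      ‖X t - e‖ ^ 2 ≤ m * ε ^ 2 / 2 / m * Real.exp (-(c / 2 / (2 * N)) * t) := by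
    intro g V X ε hε hεr hg hX h0 t ht
    have hmε : 0 < m * ε ^ 2 := by positivity
    have hmr : m * ε ^ 2 ≤ m * r ^ 2 := by gcongr
    refine norm_sq_le_exp_of_lyapunov hm hN0 (half_pos hc) hr (by positivity) (by linarith)
      hmB hNB (fun u hu => ?_) hX h0 ht
    rw [hg (show e + u ∈ closedBall e r by simpa [mem_closedBall, dist_eq_norm] using hu)]
    exact hdec u hu
  have hlt : ∀ {g : (ι → ℝ) → (ι → ℝ)} {V : Set (ι → ℝ)} {X : ℝ → ι → ℝ} {ε : ℝ},
      0 < ε → ε ≤ r → EqOn g f (closedBall e r) → IsForwardSolution g V X →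
      B (X 0 - e) (X 0 - e) ≤ m * ε ^ 2 / 2 → ∀ t, 0 ≤ t → ‖X t - e‖ < ε := by
    intro g V X ε hε hεr hg hX h0 t ht
    have h1 := hstay hε hεr hg hX h0 t ht
    have h2 : Real.exp (-(c / 2 / (2 * N)) * t) ≤ 1 :=
      Real.exp_le_one_iff.2 (mul_nonpos_of_nonpos_of_nonneg (neg_nonpos.2 (by positivity)) ht)
    have h3 : m * ε ^ 2 / 2 / m = ε ^ 2 / 2 := by field_simp
    rw [h3] at h1
    refine lt_of_pow_lt_pow_left₀ 2 hε.le ?_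
    nlinarith [sq_pos_of_pos hε]
  obtain ⟨g, L, hgK, hgL, hgf⟩ :=
    (hK.mono fun x hx => (hball hx).1.2).exists_eqOn_closedBall_bounded hr.le
  refine ⟨fun ε hε => ?_, ?_⟩
  · have hε' : 0 < min ε r := lt_min hε hr
    obtain ⟨δ, hδ, hδb⟩ := hinit (m * min ε r ^ 2 / 2) (by positivity)
    refine ⟨δ, hδ, fun X₀ _ hX₀ => ⟨?_, fun X hX h0 t ht => ?_⟩⟩
    · obtain ⟨X, hX, h0⟩ := exists_isForwardSolution_of_lipschitzWith hgK hgL X₀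
      refine ⟨X, fun t ht => ?_, h0⟩
      have hmem : X t ∈ closedBall e r := by
        rw [mem_closedBall, dist_eq_norm]
        exact ((hlt hε' (min_le_right _ _) hgf hX (hδb _ (h0 ▸ hX₀)) t ht).trans_le
          (min_le_right _ _)).le
      exact ⟨(hball hmem).1.1, hgf hmem ▸ (hX t ht).2⟩
    · exact (hlt hε' (min_le_right _ _) (fun _ _ => rfl) hX (hδb _ (h0 ▸ hX₀)) t ht).trans_le
        (min_le_left _ _)
  · obtain ⟨η, hη, hηb⟩ := hinit (m * r ^ 2 / 2) (by positivity)
    refine ⟨η, hη, fun X₀ _ hX₀ X hX h0 => ?_⟩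
    have hdecay := hstay hr le_rfl (fun _ _ => rfl) hX (hηb _ (h0 ▸ hX₀))
    have hexp : Tendsto (fun t : ℝ => m * r ^ 2 / 2 / m * Real.exp (-(c / 2 / (2 * N)) * t))
        atTop (𝓝 0) := by
      have hlim : Tendsto (fun t : ℝ => -(c / 2 / (2 * N)) * t) atTop atBot :=
        tendsto_id.const_mul_atTop_of_neg (neg_neg_of_pos (by positivity))
      simpa using (Real.tendsto_exp_atBot.comp hlim).const_mul (m * r ^ 2 / 2 / m)
    have hsq : Tendsto (fun t => ‖X t - e‖ ^ 2) atTop (𝓝 0) :=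
      squeeze_zero' (Eventually.of_forall fun _ => sq_nonneg _)
        ((eventually_ge_atTop 0).mono hdecay) hexp
    rw [tendsto_iff_norm_sub_tendsto_zero]
    simpa [Real.sqrt_sq] using hsq.sqrt

/-! ### Derivatives of the price and of the revenue terms -/

/-- At `x = 0` both sides take the default value `0`, so this is an equality of functions and can be
differentiated again. -/
theorem deriv_price : deriv price = fun x => -(x ^ 2)⁻¹ := by
  have : price = fun x : ℝ => x⁻¹ := funext fun x => one_div x
  rw [this]
  funext x
  exact deriv_inv

theorem deriv_deriv_price {x : ℝ} (hx : x ≠ 0) : deriv (deriv price) x = 2 / x ^ 3 := by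
  rw [deriv_price]
  have h := ((hasDerivAt_pow 2 x).inv (pow_ne_zero 2 hx)).neg
  refine h.deriv.trans ?_
  push_cast
  field_simp

theorem contDiffAt_price {x : ℝ} (hx : x ≠ 0) {n : WithTop ℕ∞} : ContDiffAt ℝ n price x :=
  contDiffAt_const.div contDiffAt_id hx

theorem contDiffAt_deriv_price {x : ℝ} (hx : x ≠ 0) {n : WithTop ℕ∞} :
    ContDiffAt ℝ n (deriv price) x := by
  rw [deriv_price]
  exact ((contDiffAt_id.pow 2).inv (pow_ne_zero 2 hx)).neg

/-- The gradient of the revenue discrepancy `x_i p(x₁ + x₂) - z_j`. -/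
theorem hasFDerivAt_discrepancy (i j : Fin 4) {e : Fin 4 → ℝ} (he : e 0 + e 1 ≠ 0) :
    ∃ D : (Fin 4 → ℝ) →L[ℝ] ℝ,
      HasFDerivAt (fun X : Fin 4 → ℝ => X i * price (X 0 + X 1) - X j) D e ∧
      ∀ v, D v = price (e 0 + e 1) * v i + e i * (deriv price (e 0 + e 1) * (v 0 + v 1)) - v j := by
  have hx : ∀ i, HasFDerivAt (fun X : Fin 4 → ℝ => X i) (ContinuousLinearMap.proj i) e :=
    fun i => hasFDerivAt_apply (𝕜 := ℝ) i e
  have hp := ((contDiffAt_price he (n := 1)).differentiableAt one_ne_zero).hasDerivAt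
    |>.comp_hasFDerivAt e ((hx 0).add (hx 1))
  refine ⟨_, ((hx i).mul hp).sub (hx j), fun v => ?_⟩
  simp
  ring

/-- The gradient of the marginal revenue `p(x₁ + x₂) + x_i p'(x₁ + x₂)`. -/
theorem hasFDerivAt_marginal (i : Fin 4) {e : Fin 4 → ℝ} (he : e 0 + e 1 ≠ 0) :
    ∃ D : (Fin 4 → ℝ) →L[ℝ] ℝ,
      HasFDerivAt (fun X : Fin 4 → ℝ => price (X 0 + X 1) + X i * deriv price (X 0 + X 1)) D e ∧
      ∀ v, D v = deriv price (e 0 + e 1) * (v 0 + v 1) + (deriv price (e 0 + e 1) * v i +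
        e i * (deriv (deriv price) (e 0 + e 1) * (v 0 + v 1))) := by
  have hx : ∀ i, HasFDerivAt (fun X : Fin 4 → ℝ => X i) (ContinuousLinearMap.proj i) e :=
    fun i => hasFDerivAt_apply (𝕜 := ℝ) i e
  have hp := ((contDiffAt_price he (n := 1)).differentiableAt one_ne_zero).hasDerivAt
    |>.comp_hasFDerivAt e ((hx 0).add (hx 1))
  have hdp := ((contDiffAt_deriv_price he (n := 1)).differentiableAt one_ne_zero).hasDerivAt
    |>.comp_hasFDerivAt e ((hx 0).add (hx 1))
  refine ⟨_, hp.add ((hx i).mul hdp), fun v => ?_⟩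
  simp
  ring

/-! ### Positivity of the Hurwitz determinants -/

set_option maxRecDepth 10000 in
/-- Positivity of the coefficients and Hurwitz determinants of the linearization, in scaled
variables. -/
theorem hurwitz_determinants_pos {K₁ K₂ h₁ h₂ a b : ℝ} (hK₁ : 0 < K₁) (hK₂ : 0 < K₂) (hh₁ : 0 < h₁)
    (hh₂ : 0 < h₂) (ha : 0 < a) (hb : 0 < b) {m3 m2 m1 m0 : ℝ}
    (h3 : m3 = K₁ * (1 + 2 * a) + K₂ * (1 + 2 * b) + h₁ + h₂)
    (h2 : m2 = h₁ * h₂ + K₁ * (h₂ + 2 * a * (h₁ + h₂)) + K₂ * (h₁ + 2 * b * (h₁ + h₂)) +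
      K₁ * K₂ * ((a + b) ^ 2 + 2 * (a + b)))
    (h1 : m1 = 2 * h₁ * h₂ * (K₁ * a + K₂ * b) +
      K₁ * K₂ * (h₁ + h₂) * ((a + b) ^ 2 + (a + b)))
    (h0 : m0 = K₁ * K₂ * h₁ * h₂ * (a + b) ^ 2) :
    0 < m3 ∧ 0 < m2 ∧ 0 < m1 ∧ 0 < m0 ∧ 0 < m3 * m2 - m1 ∧
      0 < m1 * (m3 * m2 - m1) - m3 ^ 2 * m0 := by
  refine ⟨by rw [h3]; positivity, by rw [h2]; positivity, by rw [h1]; positivity,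
    by rw [h0]; positivity, ?_, ?_⟩
  · rw [h3, h2, h1]
    -- In the expansion all negative monomials cancel, so only positive terms remain.
    ring_nf
    positivity
  · rw [h3, h2, h1, h0]
    ring_nf
    positivity

/-! ### The duopoly: equilibrium, linearization, stability -/

namespace DuopolyParams

variable {P : DuopolyParams}

theorem x1s_add_x2s (hP : P.Admissible) : P.x1s + P.x2s = (1 - P.t1) / (P.c1 + P.c2) := by
  have := hP.c1_pos
  have := hP.c2_pos
  have : P.c1 + P.c2 ≠ 0 := by positivity
  rw [x1s, x2s]
  field_simp
  ring

theorem x1s_pos (hP : P.Admissible) : 0 < P.x1s := by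
  have := hP.c1_pos
  have := hP.c2_pos
  have : 0 < 1 - P.t1 := sub_pos.2 hP.t1_lt_one
  rw [x1s]; positivity

theorem x2s_pos (hP : P.Admissible) : 0 < P.x2s := by
  have := hP.c1_pos
  have := hP.c2_pos
  have : 0 < 1 - P.t1 := sub_pos.2 hP.t1_lt_one
  rw [x2s]; positivity

theorem x1s_add_x2s_ne_zero (hP : P.Admissible) : P.x1s + P.x2s ≠ 0 :=
  (add_pos (x1s_pos hP) (x2s_pos hP)).ne'

theorem price_eq (hP : P.Admissible) :
    price (P.x1s + P.x2s) = (P.c1 + P.c2) / (1 - P.t1) := by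
  rw [x1s_add_x2s hP, price, one_div_div]

theorem dp_eq (hP : P.Admissible) : P.dp = -((P.c1 + P.c2) ^ 2 / (1 - P.t1) ^ 2) := by
  simp only [dp, deriv_price, x1s_add_x2s hP, div_pow, inv_div]

theorem ddp_eq (hP : P.Admissible) : P.ddp = 2 * (P.c1 + P.c2) ^ 3 / (1 - P.t1) ^ 3 := by
  rw [ddp, deriv_deriv_price (x1s_add_x2s_ne_zero hP), x1s_add_x2s hP, div_pow, div_div_eq_mul_div]

/-- The first-order condition of firm 1: marginal revenue after tax equals unit cost. It serves both
stationarity and the form of the linearized coefficients. -/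
theorem marginal1_eq (hP : P.Admissible) :
    price (P.x1s + P.x2s) + P.x1s * P.dp = P.c1 / (1 - P.t1) := by
  have := hP.c1_pos
  have := hP.c2_pos
  have : P.c1 + P.c2 ≠ 0 := by positivity
  have : 1 - P.t1 ≠ 0 := (sub_pos.2 hP.t1_lt_one).ne'
  rw [price_eq hP, dp_eq hP, x1s]
  field_simp
  ring

theorem marginal2_eq (hP : P.Admissible) :
    price (P.x1s + P.x2s) + P.x2s * P.dp = P.c2 / (1 - P.t1) := by
  have := hP.c1_pos
  have := hP.c2_pos
  have : P.c1 + P.c2 ≠ 0 := by positivity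
  have : 1 - P.t1 ≠ 0 := (sub_pos.2 hP.t1_lt_one).ne'
  rw [price_eq hP, dp_eq hP, x2s]
  field_simp
  ring

theorem discrepancy1_eq (hP : P.Admissible) :
    P.q * P.s * P.t1 * (P.x1s * price (P.x1s + P.x2s) - P.z1s) = (1 - P.q) * P.t1 := by
  have := hP.c1_pos
  have := hP.c2_pos
  have : P.c1 + P.c2 ≠ 0 := by positivity
  have : 1 - P.t1 ≠ 0 := (sub_pos.2 hP.t1_lt_one).ne'
  have := hP.q_pos.ne'
  have := (one_pos.trans_le hP.one_le_s).ne'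
  rw [price_eq hP, x1s, z1s]
  field_simp
  ring

theorem discrepancy2_eq (hP : P.Admissible) :
    P.q * P.s * P.t1 * (P.x2s * price (P.x1s + P.x2s) - P.z2s) = (1 - P.q) * P.t1 := by
  have := hP.c1_pos
  have := hP.c2_pos
  have : P.c1 + P.c2 ≠ 0 := by positivity
  have : 1 - P.t1 ≠ 0 := (sub_pos.2 hP.t1_lt_one).ne'
  have := hP.q_pos.ne'
  have := (one_pos.trans_le hP.one_le_s).ne'
  rw [price_eq hP, x2s, z2s]
  field_simp
  ring

theorem field_stationaryState (hP : P.Admissible) : P.field P.stationaryState = 0 := by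
  have hT : 1 - P.t1 ≠ 0 := (sub_pos.2 hP.t1_lt_one).ne'
  have h1 := marginal1_eq hP
  have h2 := marginal2_eq hP
  rw [dp] at h1 h2
  have e1 : 1 - P.q * P.t1 - (1 - P.q) * P.t1 = 1 - P.t1 := by ring
  funext i
  fin_cases i <;>
    simp [field, stationaryState, discrepancy1_eq hP, discrepancy2_eq hP, h1, h2, e1, hT,
      mul_div_cancel₀] <;> right <;> ring

theorem hasFDerivAt_field (hP : P.Admissible) :
    HasFDerivAt P.field (LinearMap.toContinuousLinearMap (Matrix.toLin' P.linearization))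
      P.stationaryState := by
  have he : P.stationaryState 0 + P.stationaryState 1 ≠ 0 := x1s_add_x2s_ne_zero hP
  have hm1 := marginal1_eq hP
  have hm2 := marginal2_eq hP
  have hd1 := discrepancy1_eq hP
  have hd2 := discrepancy2_eq hP
  obtain ⟨D₁, hD₁, hD₁v⟩ := hasFDerivAt_discrepancy 0 2 he
  obtain ⟨D₂, hD₂, hD₂v⟩ := hasFDerivAt_discrepancy 1 3 he
  obtain ⟨E₁, hE₁, hE₁v⟩ := hasFDerivAt_marginal 0 he
  obtain ⟨E₂, hE₂, hE₂v⟩ := hasFDerivAt_marginal 1 he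
  refine hasFDerivAt_pi'.2 fun i => ?_
  fin_cases i
  · refine (((((hD₁.const_mul (P.q * P.s * P.t1)).const_sub (1 - P.q * P.t1)).mul hE₁).sub_const
      P.c1).const_mul P.k1).congr_fderiv ?_
    ext1 v
    simp [hD₁v, hE₁v, dotProduct, Fin.sum_univ_four, linearization,
      stationaryState, a10, a01, a001]
    -- The stated coefficients carry `c1 / (1 - t1)` where differentiation produces the marginal
    -- revenue; `← hm1` reconciles the two.
    rw [hd1, ← div_pow, mul_div_assoc _ P.c1, ← hm1, dp, ddp]
    ring
  · refine (((((hD₂.const_mul (P.q * P.s * P.t1)).const_sub (1 - P.q * P.t1)).mul hE₂).sub_const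
      P.c2).const_mul P.k2).congr_fderiv ?_
    ext1 v
    simp [hD₂v, hE₂v, dotProduct, Fin.sum_univ_four, linearization,
      stationaryState, b10, b01, b001]
    rw [hd2, ← div_pow, mul_div_assoc _ P.c2, ← hm2, dp, ddp]
    ring
  · refine ((hD₁.const_mul (P.q * P.s * P.t1)).const_add (-(1 - P.q) * P.t1) |>.const_mul
      P.h1).congr_fderiv ?_
    ext1 v
    simp [hD₁v, dotProduct, Fin.sum_univ_four, linearization,
      stationaryState, c10, c01, c001]
    rw [mul_div_assoc _ P.c1, ← hm1, dp]
    ring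
  · refine ((hD₂.const_mul (P.q * P.s * P.t1)).const_add (-(1 - P.q) * P.t1) |>.const_mul
      P.h2).congr_fderiv ?_
    ext1 v
    simp [hD₂v, dotProduct, Fin.sum_univ_four, linearization,
      stationaryState, d10, d01, d001]
    rw [← hm2, dp]
    ring

theorem contDiffAt_field (hP : P.Admissible) : ContDiffAt ℝ 1 P.field P.stationaryState := by
  have he : P.stationaryState 0 + P.stationaryState 1 ≠ 0 := x1s_add_x2s_ne_zero hP
  have hx : ∀ i, ContDiffAt ℝ 1 (fun X : Fin 4 → ℝ => X i) P.stationaryState :=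
    fun i => (contDiff_apply ℝ ℝ i).contDiffAt
  have hp : ContDiffAt ℝ 1 (fun X : Fin 4 → ℝ => price (X 0 + X 1)) P.stationaryState :=
    (contDiffAt_price he (n := 1)).comp P.stationaryState ((hx 0).add (hx 1))
  have hdp : ContDiffAt ℝ 1 (fun X : Fin 4 → ℝ => deriv price (X 0 + X 1)) P.stationaryState :=
    ContDiffAt.comp (g := deriv price) _ (contDiffAt_deriv_price he) ((hx 0).add (hx 1))
  refine contDiffAt_pi.2 fun i => ?_
  fin_cases i
  · exact contDiffAt_const.mul (((contDiffAt_const.sub (contDiffAt_const.mul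
      (((hx 0).mul hp).sub (hx 2)))).mul (hp.add ((hx 0).mul hdp))).sub contDiffAt_const)
  · exact contDiffAt_const.mul (((contDiffAt_const.sub (contDiffAt_const.mul
      (((hx 1).mul hp).sub (hx 3)))).mul (hp.add ((hx 1).mul hdp))).sub contDiffAt_const)
  · exact contDiffAt_const.mul (contDiffAt_const.add (contDiffAt_const.mul
      (((hx 0).mul hp).sub (hx 2))))
  · exact contDiffAt_const.mul (contDiffAt_const.add (contDiffAt_const.mul
      (((hx 1).mul hp).sub (hx 3))))

theorem charpoly_linearization :
    P.linearization.charpoly =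
      Polynomial.X ^ 4 + Polynomial.C P.m43 * Polynomial.X ^ 3
        + Polynomial.C P.m42 * Polynomial.X ^ 2 + Polynomial.C P.m41 * Polynomial.X
        + Polynomial.C P.m40 := by
  simp only [Matrix.charpoly, linearization, m43, m42, m41, m40]
  rw [Matrix.det_succ_row_zero]
  simp [Fin.sum_univ_succ, Matrix.det_fin_three, Matrix.charmatrix_apply, Fin.succAbove,
    Matrix.submatrix_apply]
  ring

theorem stateSpace_mem_nhds (hP : P.Admissible) : stateSpace ∈ 𝓝 P.stationaryState := by
  have h0 : ∀ᶠ X : Fin 4 → ℝ in 𝓝 P.stationaryState, 0 < X 0 :=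
    (continuous_apply 0).continuousAt.eventually (lt_mem_nhds (x1s_pos hP))
  have h1 : ∀ᶠ X : Fin 4 → ℝ in 𝓝 P.stationaryState, 0 < X 1 :=
    (continuous_apply 1).continuousAt.eventually (lt_mem_nhds (x2s_pos hP))
  filter_upwards [h0, h1] with X hX0 hX1 using ⟨hX0.le, hX1.le, add_pos hX0 hX1⟩

/-- In units of `σ c₁ c₂ / T²` the cross coefficients `a01` and `b10` are `1 + (a - b)` and `1 - (a
- b)`. Their product can have either sign, but `(1 + 2a)(1 + 2b) - 1 + (a - b)² = (a + b)² + 2(a +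
b)` is positive. -/
theorem hurwitz_pos (hP : P.Admissible) :
    0 < P.m43 ∧ 0 < P.m42 ∧ 0 < P.m41 ∧ 0 < P.m40 ∧ 0 < P.m43 * P.m42 - P.m41 ∧
      0 < P.m41 * (P.m43 * P.m42 - P.m41) - P.m43 ^ 2 * P.m40 := by
  have hc1 := hP.c1_pos
  have hc2 := hP.c2_pos
  have hT : 0 < 1 - P.t1 := sub_pos.2 hP.t1_lt_one
  have hσ : 0 < P.q * P.s * P.t1 :=
    mul_pos (mul_pos hP.q_pos (one_pos.trans_le hP.one_le_s)) hP.t1_pos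
  have hC : P.c1 + P.c2 ≠ 0 := by positivity
  have hk1 := hP.k1_pos
  have hk2 := hP.k2_pos
  have hh1 := hP.h1_pos
  have hh2 := hP.h2_pos
  set σ := P.q * P.s * P.t1 with hσd
  set T := 1 - P.t1 with hTd
  have ha10 : P.a10 = -(σ * (P.c1 / T) ^ 2) * (1 + 2 * ((P.c1 + P.c2) * T / (σ * P.c1))) := by
    rw [a10, dp_eq hP, ddp_eq hP, x1s, ← hσd, ← hTd]; field_simp; ring
  have hb01 : P.b01 = -(σ * (P.c2 / T) ^ 2) * (1 + 2 * ((P.c1 + P.c2) * T / (σ * P.c2))) := by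
    rw [b01, dp_eq hP, ddp_eq hP, x2s, ← hσd, ← hTd]; field_simp; ring
  have ha01 : P.a01 = σ * P.c1 * P.c2 / T ^ 2 + (P.c1 + P.c2) * (P.c2 - P.c1) / T := by
    rw [a01, dp_eq hP, ddp_eq hP, x1s, ← hσd, ← hTd]; field_simp; ring
  have hb10 : P.b10 = σ * P.c1 * P.c2 / T ^ 2 + (P.c1 + P.c2) * (P.c1 - P.c2) / T := by
    rw [b10, dp_eq hP, ddp_eq hP, x2s, ← hσd, ← hTd]; field_simp; ring
  have hc01 : P.c01 = -(σ * P.c2 / T) := by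
    rw [c01, dp_eq hP, x1s, ← hσd, ← hTd]; field_simp
  have hd10 : P.d10 = -(σ * P.c1 / T) := by
    rw [d10, dp_eq hP, x2s, ← hσd, ← hTd]; field_simp
  have ha001 : P.a001 = σ * P.c1 / T := rfl
  have hc10 : P.c10 = σ * P.c1 / T := rfl
  have hb001 : P.b001 = σ * P.c2 / T := rfl
  have hd01 : P.d01 = σ * P.c2 / T := (mul_div_assoc _ _ _).symm
  have hc001 : P.c001 = -σ := rfl
  have hd001 : P.d001 = -σ := rfl
  refine hurwitz_determinants_pos (K₁ := P.k1 * (σ * (P.c1 / T) ^ 2)) (K₂ := P.k2 * (σ * (P.c2 / T) ^ 2))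
    (h₁ := P.h1 * σ) (h₂ := P.h2 * σ) (a := (P.c1 + P.c2) * T / (σ * P.c1))
    (b := (P.c1 + P.c2) * T / (σ * P.c2)) (by positivity) (by positivity) (by positivity)
    (by positivity) (by positivity) (by positivity) ?_ ?_ ?_ ?_
  · rw [m43, ha10, hb01, hc001, hd001]; ring
  · rw [m42, ha10, hb01, ha01, hb10, ha001, hc10, hb001, hd01, hc001, hd001]; field_simp; ring
  · rw [m41, ha10, hb01, ha01, hb10, ha001, hc10, hb001, hd01, hc001, hd001, hc01, hd10]
    field_simp; ring
  · rw [m40, ha10, hb01, ha01, hb10, ha001, hc10, hb001, hd01, hc001, hd001, hc01, hd10]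
    field_simp; ring

/-- The Routh-Hurwitz conditions hold for all admissible parameters. -/
theorem routhHurwitz (hP : P.Admissible) : P.RouthHurwitz := by
  obtain ⟨h3, -, h1, -, hD2, hD3⟩ := hurwitz_pos hP
  exact ⟨h3, hD2, hD3, mul_pos h1 hD3⟩

/-- The Routh-Hurwitz conditions force asymptotic stability. -/
theorem RouthHurwitz.isAsymptoticallyStable (hRH : P.RouthHurwitz) (hP : P.Admissible) :
    IsAsymptoticallyStable P.field stateSpace P.stationaryState := by
  -- The inequalities on `D1`, ..., `D4` alone do not force a positive constant term: `λ⁴ + λ³ + 2λ²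
  -- + λ - 1` satisfies their analogues. Hence `m40 > 0` is taken from the explicit computation.
  obtain ⟨-, h2, h1, h0, -⟩ := hurwitz_pos hP
  have hroots : ∀ z ∈ (P.linearization.charpoly.map (algebraMap ℝ ℂ)).roots, z.re < 0 := by
    intro z hz
    have := Polynomial.isRoot_of_mem_roots hz
    rw [charpoly_linearization] at this
    refine re_neg_of_quartic_routhHurwitz (m3 := P.m43) hRH.1 h1 h0 h2 hRH.2.2.1 ?_
    simpa [Polynomial.IsRoot] using this
  obtain ⟨B, m, c, hm, hc, hB⟩ := P.linearization.exists_lyapunov hroots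
  exact isAsymptoticallyStable_of_lyapunov (stateSpace_mem_nhds hP) (field_stationaryState hP)
    (contDiffAt_field hP) (hasFDerivAt_field hP) hm hc (fun u => (hB u).1) fun u => (hB u).2

end DuopolyParams

theorem proposition3 (P : DuopolyParams) (hP : P.Admissible) :
    -- the state is stationary
    P.field P.stationaryState = 0 ∧
    -- `linearization` is the linear part of the system at the stationary state
    HasFDerivAt P.field (LinearMap.toContinuousLinearMap (Matrix.toLin' P.linearization))
      P.stationaryState ∧
    -- the numbers `m43, m42, m41, m40` are the coefficients of its characteristic polynomial
    P.linearization.charpoly =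
      Polynomial.X ^ 4 + Polynomial.C P.m43 * Polynomial.X ^ 3
        + Polynomial.C P.m42 * Polynomial.X ^ 2 + Polynomial.C P.m41 * Polynomial.X
        + Polynomial.C P.m40 ∧
    (IsAsymptoticallyStable P.field DuopolyParams.stateSpace P.stationaryState ↔
      P.RouthHurwitz) :=
  ⟨DuopolyParams.field_stationaryState hP, DuopolyParams.hasFDerivAt_field hP,
    DuopolyParams.charpoly_linearization,
    fun _ => DuopolyParams.routhHurwitz hP, fun h => h.isAsymptoticallyStable hP⟩
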